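/- **Setting.** Let $p=p(\rho,e)$ be an equation of state such that, for $\rho>0$, $e>0\Leftrightarrow p(\rho,e)>0$. A state is a vector ${\bf U}=(\rho,{\bf m},{\bf B},E)\in\mathbb R^{8}$ with ${\bf m},{\bf B}\in\mathbb R^3$. Put ${\bf v}={\bf m}/\rho$, $\mathcal E({\bf U})=E-\frac12\big(|{\bf m}|^2/\rho+|{\bf B}|^2\big)$, $e=\mathcal E({\bf U})/\rho$, $p_{\rm tot}=p(\rho,e)+\frac12|{\bf B}|^2$, and let $\mathcal G=\{{\bf U}:\rho>0,\ \mathcal E({\bf U})>0\}$ be the set of admissible states. The ideal MHD fluxes are $${\bf F}_i({\bf U})=\big(\rho v_i,\ \rho v_i{\bf v}-B_i{\bf B}+p_{\rm tot}{\bf e}_i,\ v_i{\bf B}-B_i{\bf v},\ v_i(E+p_{\rm tot})-B_i({\bf v}\cdot{\bf B})\big),$$ and the Lax–Friedrichs numerical fluxes with viscosity parameters $\alpha_1^{\rm LF},\alpha_2^{\rm LF}\in\mathbb R$ are $$\hat{\bf F}_\ell({\bf U}^-,{\bf U}^+)=\tfrac12\big({\bf F}_\ell({\bf U}^-)+{\bf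 F}_\ell({\bf U}^+)-\alpha_\ell^{\rm LF}({\bf U}^+-{\bf U}^-)\big),\qquad \ell=1,2.$$ Define $\mathscr C_s=\dfrac{p}{\rho\sqrt{2e}}$, $$\mathscr C_i=\frac1{\sqrt2}\Big[\mathscr C_s^2+\tfrac{|{\bf B}|^2}{\rho}+\sqrt{\big(\mathscr C_s^2+\tfrac{|{\bf B}|^2}{\rho}\big)^2-4\tfrac{\mathscr C_s^2B_i^2}{\rho}}\Big]^{1/2},$$ and, marking the quantities of a second state $\tilde{\bf U}$ by a tilde, $\alpha_i({\bf U},\tilde{\bf U})=\min_{\sigma\in\mathbb R}\alpha_i({\bf U},\tilde{\bf U};\sigma)$ with $$\alpha_i({\bf U},\tilde{\bf U};\sigma)=\max\big\{|v_i|+\mathscr C_i,\ |\tilde v_i|+\tilde{\mathscr C}_i,\ |\sigma v_i+(1-\sigma)\tilde v_i|+\max\{\mathscr C_i,\tilde{\mathscr C}_i\}\big\}+\frac{|\tilde{\bf B}-{\bf B}|}{\sqrt2}\sqrt{\frac{\sigma^2}{\rho}+\frac{(1-\sigma)^2}{\tilde\rho}}.$$ Consider a uniform rectangular mesh with cells $I_{ij}=(x_{i-\frac12},x_{i+\frac12})\times(y_{j-\frac12},y_{j+\frac12})$,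 $(i,j)\in\mathbb Z^2$, of sizes $\Delta x,\Delta y>0$. Let $\Omega\subseteq\mathbb Z^2$ be the set of indices of the cells that make up the spatial domain ($\Omega=\mathbb Z^2$ is allowed). Each cell $I_{ij}$ carries a polynomial vector ${\bf U}^n_{ij}(x,y)$ (given by the boundary treatment in the cells outside the domain), of total degree at most $K$ if $(i,j)\in\Omega$; $\bar{\bf U}^n_{ij}$ is its average over $I_{ij}$. Let $x_i^{(\mu)},y_j^{(\mu)}$ $(1\le\mu\le Q)$ be the $Q$-point Gauss nodes in $[x_{i-\frac12},x_{i+\frac12}]$, $[y_{j-\frac12},y_{j+\frac12}]$, with weights $\omega_\mu$, $\sum_\mu\omega_\mu=1$, $Q\ge (K+1)/2$. Let $\hat x_i^{(\nu)},\hat y_j^{(\nu)}$ $(1\le\nu\le L)$ be the $L$-point Gauss–Lobatto nodes in these intervals, with weights $\hat\omega_\nu$, $\sum_\nu\hat\omega_\nu=1$, $L\ge\max\{2,(K+3)/2\}$. Write $${\bf U}^{-,\mu}_{i+\frac12,j}={\bf U}^n_{ij}(x_{i+\frac12},y_j^{(\mu)}),\quad {\bf U}^{+,\mu}_{i-\frac12,j}={\bf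 U}^n_{ij}(x_{i-\frac12},y_j^{(\mu)}),\quad {\bf U}^{\mu,-}_{i,j+\frac12}={\bf U}^n_{ij}(x_i^{(\mu)},y_{j+\frac12}),\quad {\bf U}^{\mu,+}_{i,j-\frac12}={\bf U}^n_{ij}(x_i^{(\mu)},y_{j-\frac12}).$$ The updated cell averages (finite volume scheme, or cell-average equation of a DG method, with forward Euler step $\Delta t_n$) are $$\begin{aligned}\bar{\bf U}^{n+1}_{ij}=\bar{\bf U}^n_{ij}&-\frac{\Delta t_n}{\Delta x}\sum_{\mu=1}^Q\omega_\mu\Big(\hat{\bf F}_1({\bf U}^{-,\mu}_{i+\frac12,j},{\bf U}^{+,\mu}_{i+\frac12,j})-\hat{\bf F}_1({\bf U}^{-,\mu}_{i-\frac12,j},{\bf U}^{+,\mu}_{i-\frac12,j})\Big)\\&-\frac{\Delta t_n}{\Delta y}\sum_{\mu=1}^Q\omega_\mu\Big(\hat{\bf F}_2({\bf U}^{\mu,-}_{i,j+\frac12},{\bf U}^{\mu,+}_{i,j+\frac12})-\hat{\bf F}_2({\bf U}^{\mu,-}_{i,j-\frac12},{\bf U}^{\mu,+}_{i,j-\frac12})\Big).\end{aligned}$$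 With $\overline{(B_1)}^{\mu}_{i+\frac12,j}=\frac12\big((B_1)^{-,\mu}_{i+\frac12,j}+(B_1)^{+,\mu}_{i+\frac12,j}\big)$ and $\overline{(B_2)}^{\mu}_{i,j+\frac12}=\frac12\big((B_2)^{\mu,-}_{i,j+\frac12}+(B_2)^{\mu,+}_{i,j+\frac12}\big)$, the discrete divergence is $$\operatorname{div}_{ij}{\bf B}^n=\frac1{\Delta x}\sum_{\mu=1}^Q\omega_\mu\Big(\overline{(B_1)}^{\mu}_{i+\frac12,j}-\overline{(B_1)}^{\mu}_{i-\frac12,j}\Big)+\frac1{\Delta y}\sum_{\mu=1}^Q\omega_\mu\Big(\overline{(B_2)}^{\mu}_{i,j+\frac12}-\overline{(B_2)}^{\mu}_{i,j-\frac12}\Big).$$ **Theorem.** Suppose that 1. $\operatorname{div}_{ij}{\bf B}^n=0$ for all $(i,j)\in\Omega$; 2. ${\bf U}^n_{ij}(\hat x_i^{(\nu)},y_j^{(\mu)})\in\mathcal G$ and ${\bf U}^n_{ij}(x_i^{(\mu)},\hat y_j^{(\nu)})\in\mathcal G$ for all $\mu,\nu$ and all $(i,j)$ that lie in $\Omega$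 or index a cell sharing an edge with a cell of the domain; 3. for all $(i,j)\in\Omega$, all $\mu$ and both choices of the sign, $\alpha_1^{\rm LF}>\alpha_1\big({\bf U}^{\pm,\mu}_{i+\frac12,j},{\bf U}^{\pm,\mu}_{i-\frac12,j}\big)$ and $\alpha_2^{\rm LF}>\alpha_2\big({\bf U}^{\mu,\pm}_{i,j+\frac12},{\bf U}^{\mu,\pm}_{i,j-\frac12}\big)$ (the same sign in both arguments); 4. $0<\dfrac{\alpha_1^{\rm LF}\Delta t_n}{\Delta x}+\dfrac{\alpha_2^{\rm LF}\Delta t_n}{\Delta y}\le\hat\omega_1$. Then $\bar{\bf U}^{n+1}_{ij}\in\mathcal G$ for all $(i,j)\in\Omega$. -/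

import Mathlib

noncomputable section

namespace MHD

/-- The three-dimensional Euclidean space of velocities and magnetic fields. -/
abbrev V3 := EuclideanSpace ℝ (Fin 3)

/-- The conservative vector `U = (ρ, m₁, m₂, m₃, B₁, B₂, B₃, E)`. -/
abbrev State := Fin 8 → ℝ

/-- Density. -/
def rho (U : State) : ℝ := U 0

/-- Momentum density `m = ρ v`. -/
def mom (U : State) : V3 := !₂[U 1, U 2, U 3]

/-- Magnetic field. -/
def mag (U : State) : V3 := !₂[U 4, U 5, U 6]

/-- Total energy. -/
def energy (U : State) : ℝ := U 7

/-- Fluid velocity `v = m / ρ`. -/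
def vel (U : State) : V3 := (rho U)⁻¹ • mom U

/-- The internal energy `𝓔(U) = E - (|m|² / ρ + |B|²) / 2 = ρ e`. -/
def internalEnergy (U : State) : ℝ :=
  energy U - (1 / 2) * (‖mom U‖ ^ 2 / rho U + ‖mag U‖ ^ 2)

/-- The set of admissible states. -/
def admissible : Set State := {U | 0 < rho U ∧ 0 < internalEnergy U}

/-- Specific internal energy `e = 𝓔(U) / ρ`. -/
def specificEnergy (U : State) : ℝ := internalEnergy U / rho U

/-- An equation of state `p = p(ρ, e)` is acceptable if for `ρ > 0` one has
`e > 0 ↔ p(ρ, e) > 0`. -/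
def IsEOS (p : ℝ → ℝ → ℝ) : Prop :=
  ∀ ρ e : ℝ, 0 < ρ → (0 < e ↔ 0 < p ρ e)

/-- Gas pressure of a state, for the equation of state `p`. -/
def pressure (p : ℝ → ℝ → ℝ) (U : State) : ℝ := p (rho U) (specificEnergy U)

/-- Total pressure: gas pressure plus magnetic pressure `|B|² / 2`. -/
def totalPressure (p : ℝ → ℝ → ℝ) (U : State) : ℝ := pressure p U + ‖mag U‖ ^ 2 / 2

/-- The momentum part of the flux in direction `i`: `ρ vᵢ v - Bᵢ B + p_tot eᵢ`. -/
def momFlux (p : ℝ → ℝ → ℝ) (i : Fin 3) (U : State) : V3 :=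
  (rho U * vel U i) • vel U - mag U i • mag U
    + totalPressure p U • EuclideanSpace.single i (1 : ℝ)

/-- The magnetic part of the flux in direction `i`: `vᵢ B - Bᵢ v`. -/
def magFlux (i : Fin 3) (U : State) : V3 :=
  vel U i • mag U - mag U i • vel U

/-- The flux `Fᵢ(U)` of ideal magnetohydrodynamics in direction `i`. -/
def flux (p : ℝ → ℝ → ℝ) (i : Fin 3) (U : State) : State :=
  ![rho U * vel U i,
    momFlux p i U 0, momFlux p i U 1, momFlux p i U 2,
    magFlux i U 0, magFlux i U 1, magFlux i U 2,
    vel U i * (energy U + totalPressure p U) - mag U i * inner ℝ (vel U) (mag U)]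

/-- The Lax–Friedrichs numerical flux in direction `i` with viscosity parameter `α`. -/
def lfFlux (p : ℝ → ℝ → ℝ) (i : Fin 3) (α : ℝ) (Um Up : State) : State :=
  (1 / 2 : ℝ) • (flux p i Um + flux p i Up - α • (Up - Um))

/-- The speed `𝒞ₛ = p / (ρ √(2 e))`. -/
def cs (p : ℝ → ℝ → ℝ) (U : State) : ℝ :=
  pressure p U / (rho U * √(2 * specificEnergy U))

/-- The speed
`𝒞ᵢ = 2^{-1/2} [𝒞ₛ² + |B|²/ρ + ((𝒞ₛ² + |B|²/ρ)² - 4 𝒞ₛ² Bᵢ²/ρ)^{1/2}]^{1/2}`. -/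
def ci (p : ℝ → ℝ → ℝ) (i : Fin 3) (U : State) : ℝ :=
  (1 / √2) * √(cs p U ^ 2 + ‖mag U‖ ^ 2 / rho U
    + √((cs p U ^ 2 + ‖mag U‖ ^ 2 / rho U) ^ 2 - 4 * (cs p U ^ 2 * mag U i ^ 2 / rho U)))

/-- The quantity `αᵢ(U, U'; σ)`. -/
def alphaSigma (p : ℝ → ℝ → ℝ) (i : Fin 3) (U U' : State) (σ : ℝ) : ℝ :=
  max (max (|vel U i| + ci p i U) (|vel U' i| + ci p i U'))
      (|σ * vel U i + (1 - σ) * vel U' i| + max (ci p i U) (ci p i U'))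
    + ‖mag U' - mag U‖ / √2 * √(σ ^ 2 / rho U + (1 - σ) ^ 2 / rho U')

/-- `αᵢ(U, U') = min_σ αᵢ(U, U'; σ)`; for states of positive density the family is nonnegative,
and continuous and either constant or coercive in `σ`, so the infimum is a minimum. -/
def alpha (p : ℝ → ℝ → ℝ) (i : Fin 3) (U U' : State) : ℝ :=
  ⨅ σ : ℝ, alphaSigma p i U U' σ

/-- `ξ, w` are the nodes and normalized weights of the `Q`-point Gauss quadrature rule on
`[0, 1]`: the unique `Q`-point rule that is exact for all polynomials of degree at most
`2 Q - 1`. -/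
def IsGaussRule {Q : ℕ} (ξ w : Fin Q → ℝ) : Prop :=
  StrictMono ξ ∧
  ∀ P : Polynomial ℝ, P.natDegree < 2 * Q →
    ∑ μ, w μ * P.eval (ξ μ) = ∫ t in (0 : ℝ)..1, P.eval t

/-- `ξ, w` are the nodes and normalized weights of the `L`-point Gauss–Lobatto quadrature rule on
`[0, 1]`: the unique `L`-point rule that has both endpoints among its nodes and is exact for all
polynomials of degree at most `2 L - 3`. -/
def IsGaussLobattoRule {L : ℕ} (hL : 2 ≤ L) (ξ w : Fin L → ℝ) : Prop :=
  StrictMono ξ ∧ ξ ⟨0, by omega⟩ = 0 ∧ ξ ⟨L - 1, by omega⟩ = 1 ∧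
  ∀ P : Polynomial ℝ, P.natDegree + 3 ≤ 2 * L →
    ∑ ν, w ν * P.eval (ξ ν) = ∫ t in (0 : ℝ)..1, P.eval t

/-- A uniform rectangular mesh of the plane. Its cells are
`I_{ij} = (x_{i-1/2}, x_{i+1/2}) × (y_{j-1/2}, y_{j+1/2})`, with centre
`(x₀ + i Δx, y₀ + j Δy)`. -/
structure Mesh where
  x₀ : ℝ
  y₀ : ℝ
  Δx : ℝ
  Δy : ℝ
  Δx_pos : 0 < Δx
  Δy_pos : 0 < Δy

/-- `x_{i-1/2}`. -/
def Mesh.xL (M : Mesh) (i : ℤ) : ℝ := M.x₀ + ((i : ℝ) - 1 / 2) * M.Δx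
/-- `x_{i+1/2}`. -/
def Mesh.xR (M : Mesh) (i : ℤ) : ℝ := M.x₀ + ((i : ℝ) + 1 / 2) * M.Δx
/-- `y_{j-1/2}`. -/
def Mesh.yL (M : Mesh) (j : ℤ) : ℝ := M.y₀ + ((j : ℝ) - 1 / 2) * M.Δy
/-- `y_{j+1/2}`. -/
def Mesh.yR (M : Mesh) (j : ℤ) : ℝ := M.y₀ + ((j : ℝ) + 1 / 2) * M.Δy

/-- The image in `[x_{i-1/2}, x_{i+1/2}]` of the point `t` of the reference interval `[0, 1]`. -/
def Mesh.xPt (M : Mesh) (i : ℤ) (t : ℝ) : ℝ := M.xL i + t * M.Δx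
/-- The image in `[y_{j-1/2}, y_{j+1/2}]` of the point `t` of the reference interval `[0, 1]`. -/
def Mesh.yPt (M : Mesh) (j : ℤ) (t : ℝ) : ℝ := M.yL j + t * M.Δy

/-- A vector of eight polynomials in the two variables `(x, y)`. -/
abbrev PolyState := Fin 8 → MvPolynomial (Fin 2) ℝ

/-- The value of a polynomial vector at `(x, y)`. -/
def PolyState.at (P : PolyState) (x y : ℝ) : State := fun k => MvPolynomial.eval ![x, y] (P k)

/-- The average over the cell `I_{ij}` of the polynomial vector of that cell. -/
def cellAverage (M : Mesh) (U : ℤ → ℤ → PolyState) (i j : ℤ) : State := fun k =>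
  (1 / (M.Δx * M.Δy)) *
    ∫ x in (M.xL i)..(M.xR i), ∫ y in (M.yL j)..(M.yR j), (U i j).at x y k

section Scheme

variable (M : Mesh) {Q : ℕ} (ξ w : Fin Q → ℝ) (U : ℤ → ℤ → PolyState)

/-- `U^{-,μ}_{i+1/2,j} = U_{ij}(x_{i+1/2}, y_j^{(μ)})`. -/
def xMinus (i j : ℤ) (μ : Fin Q) : State := (U i j).at (M.xR i) (M.yPt j (ξ μ))

/-- `U^{+,μ}_{i+1/2,j} = U_{i+1,j}(x_{i+1/2}, y_j^{(μ)})`. -/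
def xPlus (i j : ℤ) (μ : Fin Q) : State := (U (i + 1) j).at (M.xL (i + 1)) (M.yPt j (ξ μ))

/-- `U^{μ,-}_{i,j+1/2} = U_{ij}(x_i^{(μ)}, y_{j+1/2})`. -/
def yMinus (i j : ℤ) (μ : Fin Q) : State := (U i j).at (M.xPt i (ξ μ)) (M.yR j)

/-- `U^{μ,+}_{i,j+1/2} = U_{i,j+1}(x_i^{(μ)}, y_{j+1/2})`. -/
def yPlus (i j : ℤ) (μ : Fin Q) : State := (U i (j + 1)).at (M.xPt i (ξ μ)) (M.yL (j + 1))

/-- The new cell average, after one forward Euler step of size `Δt`. An interface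
`i - 1/2` is written `(i - 1) + 1/2`; directions `1, 2` are the indices `0, 1`. -/
def updatedAverage (p : ℝ → ℝ → ℝ) (α₁ α₂ Δt : ℝ) (i j : ℤ) : State :=
  cellAverage M U i j
  - (Δt / M.Δx) • ∑ μ, w μ •
      (lfFlux p 0 α₁ (xMinus M ξ U i j μ) (xPlus M ξ U i j μ)
        - lfFlux p 0 α₁ (xMinus M ξ U (i - 1) j μ) (xPlus M ξ U (i - 1) j μ))
  - (Δt / M.Δy) • ∑ μ, w μ •
      (lfFlux p 1 α₂ (yMinus M ξ U i j μ) (yPlus M ξ U i j μ)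
        - lfFlux p 1 α₂ (yMinus M ξ U i (j - 1) μ) (yPlus M ξ U i (j - 1) μ))

/-- The mean of the two one-sided values of `B₁` at a Gauss point of the interface `i + 1/2`. -/
def meanB₁ (i j : ℤ) (μ : Fin Q) : ℝ :=
  (1 / 2) * (mag (xMinus M ξ U i j μ) 0 + mag (xPlus M ξ U i j μ) 0)

/-- The mean of the two one-sided values of `B₂` at a Gauss point of the interface `j + 1/2`. -/
def meanB₂ (i j : ℤ) (μ : Fin Q) : ℝ :=
  (1 / 2) * (mag (yMinus M ξ U i j μ) 1 + mag (yPlus M ξ U i j μ) 1)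

/-- The discrete divergence `div_{ij} B` of the numerical magnetic field. -/
def discreteDiv (i j : ℤ) : ℝ :=
  (∑ μ, w μ * (meanB₁ M ξ U i j μ - meanB₁ M ξ U (i - 1) j μ)) / M.Δx
  + (∑ μ, w μ * (meanB₂ M ξ U i j μ - meanB₂ M ξ U i (j - 1) μ)) / M.Δy

end Scheme

/-- The cell `(i, j)` belongs to `Ω` or shares an edge with a cell of `Ω`. -/
def InStencil (Ω : Set (ℤ × ℤ)) (i j : ℤ) : Prop :=
  (i, j) ∈ Ω ∨ (i + 1, j) ∈ Ω ∨ (i - 1, j) ∈ Ω ∨ (i, j + 1) ∈ Ω ∨ (i, j - 1) ∈ Ω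

end MHD

end

open MHD

/-! The set of admissible states is cut out by affine inequalities: besides ρ > 0, one needs n⋆ · U
+ |c|²/2 > 0 for all a, c in ℝ³, where n⋆ is `normalVec a c`. It therefore suffices to propagate the
positivity of one affine functional at a time (`updatedAverage_functional_pos`); the density is
another such functional.

The difficulty is that a flux difference paired with n⋆ is not bounded by α times the functional: it
contains (a · c) times the jump of Bᵢ. The splitting estimate `normalVec_flux_sub_lt` bounds what
remains once that term is removed, for two states at opposite edges of a cell. It rests on
`abs_pressure_magnetic_work_le`, where 𝒞ᵢ appears as the norm of a bilinear form, and on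
`cross_term_le`, which produces the term with |B̃ - B|. The factor a · c depends neither on the
states nor on the direction, so after summation over the edges it multiplies the discrete
divergence, which is zero.

Adding the estimates for the outer and the inner traces, the viscosity cancels all outer traces.
What is left is α times the functional at the inner traces, which are Gauss–Lobatto endpoints of the
cell. Since the quadrature weights are positive and the endpoint weights equal, the cell average
dominates these contributions under the CFL condition. -/

namespace MHD

/-! ### Linear description of the admissible set -/

/-- The vector `n⋆ = (|a|²/2, -a, -c, 1)` whose pairings with states characterize admissibility. -/
noncomputable def normalVec (a c : V3) : State :=
  ![‖a‖ ^ 2 / 2, -a 0, -a 1, -a 2, -c 0, -c 1, -c 2, 1]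

/-- Completing the square in the velocity and in the magnetic field. At a = v, c = B only the
internal energy survives. -/
lemma normalVec_dotProduct (a c : V3) {U : State} (h : rho U ≠ 0) :
    normalVec a c ⬝ᵥ U + ‖c‖ ^ 2 / 2
      = rho U * ‖vel U - a‖ ^ 2 / 2 + ‖mag U - c‖ ^ 2 / 2 + internalEnergy U := by
  simp only [rho] at h
  simp only [normalVec, dotProduct, Fin.sum_univ_eight, vel, mag, mom, internalEnergy, rho, energy,
    EuclideanSpace.real_norm_sq_eq, Fin.sum_univ_three, PiLp.sub_apply, PiLp.smul_apply, smul_eq_mul]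
  simp
  field_simp
  ring

/-- The grouping is chosen for the splitting estimate: kinetic and internal energy are transported
with vᵢ, the shifted magnetic energy with aᵢ, and the bracket is controlled by 𝒞ᵢ. The first term is
the one removed by the divergence condition; the last equals its counterpart at any other state. -/
lemma normalVec_dotProduct_flux (p : ℝ → ℝ → ℝ) (i : Fin 3) (a c : V3) {U : State}
    (h : rho U ≠ 0) :
    normalVec a c ⬝ᵥ flux p i U
      = mag U i * inner ℝ a c + vel U i * (rho U * ‖vel U - a‖ ^ 2 / 2 + internalEnergy U)
        + a i * (‖mag U - c‖ ^ 2 / 2)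
        + ((vel U i - a i) * pressure p U + (vel U i - a i) * inner ℝ (mag U) (mag U - c)
          - mag U i * inner ℝ (vel U - a) (mag U - c))
        - a i * ‖c‖ ^ 2 / 2 := by
  simp only [rho] at h
  generalize hP : pressure p U = P
  simp only [normalVec, dotProduct, Fin.sum_univ_eight, vel, mag, mom, internalEnergy, rho, energy,
    EuclideanSpace.real_norm_sq_eq, Fin.sum_univ_three, PiLp.sub_apply, PiLp.smul_apply,
    smul_eq_mul, flux, momFlux, magFlux, totalPressure, PiLp.inner_apply, hP]
  fin_cases i <;> simp <;> field_simp <;> ring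

/-- States pairing positively with all vectors `n⋆` are admissible. -/
lemma mem_admissible_of_normalVec {U : State} (h : 0 < rho U)
    (H : ∀ a c : V3, 0 < normalVec a c ⬝ᵥ U + ‖c‖ ^ 2 / 2) : U ∈ admissible := by
  refine ⟨h, ?_⟩
  have := H (vel U) (mag U)
  rw [normalVec_dotProduct _ _ h.ne'] at this
  simpa using this

lemma normalVec_dotProduct_pos (a c : V3) {U : State} (h : U ∈ admissible) :
    0 < normalVec a c ⬝ᵥ U + ‖c‖ ^ 2 / 2 := by
  rw [normalVec_dotProduct _ _ h.1.ne']
  have := h.1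
  have := h.2
  positivity

/-! ### The fast magnetosonic speed as the norm of a bilinear form -/

/-- A bilinear form bounded by the fast magnetosonic speed `c`, whose square is the largest root of
`X² - (s² + |β|²) X + s² β₁²`. -/
lemma abs_fastForm_le {s β₁ β₂ β₃ c : ℝ} (hc : 0 ≤ c)
    (h1 : β₁ ^ 2 ≤ c ^ 2) (h2 : s ^ 2 + (β₁ ^ 2 + β₂ ^ 2 + β₃ ^ 2) ≤ 2 * c ^ 2)
    (h3 : (c ^ 2) ^ 2 - (s ^ 2 + (β₁ ^ 2 + β₂ ^ 2 + β₃ ^ 2)) * c ^ 2 + s ^ 2 * β₁ ^ 2 = 0)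
    (x₁ x₂ x₃ z b₂ b₃ : ℝ) :
    |s * x₁ * z + x₁ * (β₂ * b₂ + β₃ * b₃) - β₁ * (x₂ * b₂ + x₃ * b₃)|
      ≤ c * ((x₁ ^ 2 + x₂ ^ 2 + x₃ ^ 2) / 2 + (z ^ 2 + b₂ ^ 2 + b₃ ^ 2) / 2) := by
  -- Cauchy–Schwarz in (z, b₂, b₃) reduces the claim to this norm bound. Multiplied by c² - β₁², it
  -- becomes a sum of squares by the quadratic equation; if c² = β₁², that equation forces β₁β₂ =
  -- β₁β₃ = 0.
  have key : (s * x₁) ^ 2 + (β₂ * x₁ - β₁ * x₂) ^ 2 + (β₃ * x₁ - β₁ * x₃) ^ 2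
      ≤ c ^ 2 * (x₁ ^ 2 + x₂ ^ 2 + x₃ ^ 2) := by
    rcases h1.eq_or_lt with h | h
    · have e : β₁ ^ 2 * β₂ ^ 2 + β₁ ^ 2 * β₃ ^ 2 = 0 := by rw [← h] at h3; linarith
      have e2 : β₁ * β₂ = 0 := by nlinarith [sq_nonneg (β₁ * β₂), sq_nonneg (β₁ * β₃)]
      have e3 : β₁ * β₃ = 0 := by nlinarith [sq_nonneg (β₁ * β₂), sq_nonneg (β₁ * β₃)]
      have : 0 ≤ (c ^ 2 - s ^ 2 - β₂ ^ 2 - β₃ ^ 2) * x₁ ^ 2 :=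
        mul_nonneg (by linarith) (sq_nonneg _)
      have : (β₂ * x₁ - β₁ * x₂) ^ 2 + (β₃ * x₁ - β₁ * x₃) ^ 2
          = (β₂ ^ 2 + β₃ ^ 2) * x₁ ^ 2 + β₁ ^ 2 * (x₂ ^ 2 + x₃ ^ 2) := by
        linear_combination (-2 * x₁ * x₂) * e2 + (-2 * x₁ * x₃) * e3
      rw [h] at this
      linarith
    · have hD : 0 < c ^ 2 - β₁ ^ 2 := by linarith
      rw [← sub_nonneg]
      refine nonneg_of_mul_nonneg_right (a := c ^ 2 - β₁ ^ 2) ?_ hD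
      have : (c ^ 2 - β₁ ^ 2) * (c ^ 2 * (x₁ ^ 2 + x₂ ^ 2 + x₃ ^ 2)
          - ((s * x₁) ^ 2 + (β₂ * x₁ - β₁ * x₂) ^ 2 + (β₃ * x₁ - β₁ * x₃) ^ 2))
          = ((c ^ 2 - β₁ ^ 2) * x₂ + β₁ * β₂ * x₁) ^ 2
            + ((c ^ 2 - β₁ ^ 2) * x₃ + β₁ * β₃ * x₁) ^ 2 := by
        linear_combination x₁ ^ 2 * h3
      rw [this]
      positivity
  set X := x₁ ^ 2 + x₂ ^ 2 + x₃ ^ 2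
  set Y := z ^ 2 + b₂ ^ 2 + b₃ ^ 2
  have hX : 0 ≤ X := by positivity
  have hY : 0 ≤ Y := by positivity
  have cs : (s * x₁ * z + x₁ * (β₂ * b₂ + β₃ * b₃) - β₁ * (x₂ * b₂ + x₃ * b₃)) ^ 2
      ≤ ((s * x₁) ^ 2 + (β₂ * x₁ - β₁ * x₂) ^ 2 + (β₃ * x₁ - β₁ * x₃) ^ 2) * Y := by
    nlinarith [sq_nonneg (s * x₁ * b₂ - (β₂ * x₁ - β₁ * x₂) * z),
      sq_nonneg (s * x₁ * b₃ - (β₃ * x₁ - β₁ * x₃) * z),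
      sq_nonneg ((β₂ * x₁ - β₁ * x₂) * b₃ - (β₃ * x₁ - β₁ * x₃) * b₂)]
  refine abs_le_of_sq_le_sq (cs.trans ?_) (by positivity)
  calc _ ≤ c ^ 2 * X * Y := by gcongr
    _ ≤ _ := by nlinarith [mul_nonneg (sq_nonneg c) (sq_nonneg (X - Y))]

lemma cs_pos {p : ℝ → ℝ → ℝ} (hp : IsEOS p) {U : State} (h : U ∈ admissible) : 0 < cs p U := by
  have h1 := h.1
  have h2 : 0 < specificEnergy U := div_pos h.2 h.1
  have h3 : 0 < pressure p U := (hp _ _ h1).1 h2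
  unfold cs
  positivity

lemma sq_coord_le (B : V3) (i : Fin 3) : B i ^ 2 ≤ ‖B‖ ^ 2 := by
  rw [EuclideanSpace.real_norm_sq_eq]
  exact Finset.single_le_sum (f := fun j => B j ^ 2) (fun j _ => sq_nonneg _) (Finset.mem_univ i)

lemma ci_pos {p : ℝ → ℝ → ℝ} (hp : IsEOS p) {U : State} (h : U ∈ admissible) (i : Fin 3) :
    0 < ci p i U := by
  have := cs_pos hp h
  have := h.1
  unfold ci
  positivity

/-- The square of the speed `𝒞ᵢ` is the largest root of its characteristic quadratic. -/
lemma ci_sq_spec (p : ℝ → ℝ → ℝ) {U : State} (h : 0 < rho U) (i : Fin 3) :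
    mag U i ^ 2 / rho U ≤ ci p i U ^ 2 ∧
    cs p U ^ 2 + ‖mag U‖ ^ 2 / rho U ≤ 2 * ci p i U ^ 2 ∧
    (ci p i U ^ 2) ^ 2 - (cs p U ^ 2 + ‖mag U‖ ^ 2 / rho U) * ci p i U ^ 2
      + cs p U ^ 2 * (mag U i ^ 2 / rho U) = 0 := by
  have hle : mag U i ^ 2 / rho U ≤ ‖mag U‖ ^ 2 / rho U := by
    exact div_le_div_of_nonneg_right (sq_coord_le _ _) h.le
  have h0 : 0 ≤ mag U i ^ 2 / rho U := by positivity
  have hs : 0 ≤ cs p U ^ 2 := by positivity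
  have e : ci p i U ^ 2 = (1 / 2) * (cs p U ^ 2 + ‖mag U‖ ^ 2 / rho U
    + √((cs p U ^ 2 + ‖mag U‖ ^ 2 / rho U) ^ 2 - 4 * (cs p U ^ 2 * (mag U i ^ 2 / rho U)))) := by
    unfold ci
    rw [mul_pow, Real.sq_sqrt (by positivity), div_pow, Real.sq_sqrt (by norm_num), mul_div_assoc (cs p U ^ 2)]
    norm_num
  rw [e]
  generalize cs p U ^ 2 = S at *
  generalize ‖mag U‖ ^ 2 / rho U = T at *
  generalize mag U i ^ 2 / rho U = t at *
  -- For T = t this is an equality, and t ≤ T. It gives both a nonnegative discriminant and the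
  -- lower bound t - S for its root, hence t ≤ 𝒞ᵢ².
  have hd : (S - t) ^ 2 ≤ (S + T) ^ 2 - 4 * (S * t) := by nlinarith
  have hd0 := (sq_nonneg _).trans hd
  have h1 := Real.sqrt_nonneg ((S + T) ^ 2 - 4 * (S * t))
  have h2 := Real.sq_sqrt hd0
  have h3 := Real.abs_le_sqrt hd
  refine ⟨?_, by linarith, by linear_combination (1 / 4) * h2⟩
  have := neg_le_of_abs_le h3
  linarith

/-- With x = √ρ u, z = √(2𝓔) and β = B/√ρ, the pressure is 𝒞ₛ √ρ z and the left side is the form in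
`abs_fastForm_le`. The components of b along direction i cancel. -/
lemma abs_pressure_magnetic_work_le {p : ℝ → ℝ → ℝ} (hp : IsEOS p) {U : State}
    (h : U ∈ admissible) (i : Fin 3) (u b : V3) :
    |u i * pressure p U + u i * inner ℝ (mag U) b - mag U i * inner ℝ u b|
      ≤ ci p i U * (rho U * ‖u‖ ^ 2 / 2 + internalEnergy U + ‖b‖ ^ 2 / 2) := by
  obtain ⟨h1, h2, h3⟩ := ci_sq_spec p h.1 i
  have hc := (ci_pos hp h i).le
  have hρ := h.1
  have hε := h.2
  have he : 0 < specificEnergy U := div_pos h.2 h.1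
  have hpr : pressure p U = cs p U * (√(rho U) * √(2 * internalEnergy U)) := by
    have e1 : √(2 * internalEnergy U) = √(rho U) * √(2 * specificEnergy U) := by
      rw [← Real.sqrt_mul hρ.le, specificEnergy]
      congr 1
      field_simp
    have : √(2 * specificEnergy U) ≠ 0 := by positivity
    rw [e1, ← mul_assoc (√(rho U)), Real.mul_self_sqrt hρ.le, cs]
    field_simp
  obtain ⟨r, hr, hr2⟩ : ∃ r : ℝ, 0 < r ∧ rho U = r ^ 2 :=
    ⟨√(rho U), by positivity, (Real.sq_sqrt hρ.le).symm⟩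
  obtain ⟨z, hz, hz2⟩ : ∃ z : ℝ, 0 ≤ z ∧ 2 * internalEnergy U = z ^ 2 :=
    ⟨√(2 * internalEnergy U), by positivity, (Real.sq_sqrt (by positivity)).symm⟩
  have hε2 : internalEnergy U = z ^ 2 / 2 := by linarith
  rw [hz2, hr2, Real.sqrt_sq hr.le, Real.sqrt_sq hz] at hpr
  rw [hpr, hr2, hε2]
  rw [hr2] at h1 h2 h3
  generalize ci p i U = c at *
  generalize cs p U = s at *
  generalize mag U = B at *
  simp only [EuclideanSpace.real_norm_sq_eq, Fin.sum_univ_three, PiLp.inner_apply] at h2 h3 ⊢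
  -- Here j, k stand for the two directions transverse to i.
  have key : ∀ j k : Fin 3, B 0 ^ 2 + B 1 ^ 2 + B 2 ^ 2 = B i ^ 2 + B j ^ 2 + B k ^ 2 →
      |u i * (s * (r * z)) + u i * (B j * b j + B k * b k) - B i * (u j * b j + u k * b k)|
      ≤ c * (r ^ 2 * (u i ^ 2 + u j ^ 2 + u k ^ 2) / 2 + z ^ 2 / 2 + (b j ^ 2 + b k ^ 2) / 2) := by
    intro j k hjk
    rw [hjk] at h2 h3
    have e : ∀ l, (B l / r) ^ 2 = B l ^ 2 / r ^ 2 := fun l => div_pow _ _ _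
    have := abs_fastForm_le (s := s) (β₁ := B i / r) (β₂ := B j / r) (β₃ := B k / r) hc
      (by rw [e]; exact h1) (by simp only [e, ← add_div]; exact h2)
      (by simp only [e, ← add_div]; exact h3) (r * u i) (r * u j) (r * u k) z (b j) (b k)
    convert this using 2
    · field_simp
    · ring
  fin_cases i
  · refine (le_of_eq ?_).trans ((key 1 2 (by simp)).trans ?_)
    · simp; congr 1; ring
    · refine mul_le_mul_of_nonneg_left ?_ hc
      simp only [Fin.zero_eta]
      linarith [sq_nonneg (b 0)]
  · refine (le_of_eq ?_).trans ((key 0 2 (by simp; ring)).trans ?_)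
    · simp; congr 1; ring
    · refine mul_le_mul_of_nonneg_left ?_ hc
      simp only [Fin.mk_one]
      linarith [sq_nonneg (b 1)]
  · refine (le_of_eq ?_).trans ((key 0 1 (by simp; ring)).trans ?_)
    · simp; congr 1; ring
    · refine mul_le_mul_of_nonneg_left ?_ hc
      simp only [Fin.reduceFinMk]
      linarith [sq_nonneg (b 2)]

/-! ### Exact quadrature rules and positivity of Gauss weights -/

open Polynomial in
/-- A quadrature rule on `[0, 1]` that is exact up to degree `K`. -/
def ExactUpTo {n : ℕ} (ξ w : Fin n → ℝ) (K : ℕ) : Prop :=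
  ∀ P : ℝ[X], P.natDegree ≤ K → ∑ μ, w μ * P.eval (ξ μ) = ∫ t in (0 : ℝ)..1, P.eval t

lemma ExactUpTo.sum_weights {n : ℕ} {ξ w : Fin n → ℝ} {K : ℕ} (h : ExactUpTo ξ w K) :
    ∑ μ, w μ = 1 := by
  simpa using h 1 (by simp)

open Polynomial in
/-- A nonzero polynomial that is nonnegative on `[0, 1]` has a positive integral. -/
lemma integral_eval_pos {P : ℝ[X]} (h0 : P ≠ 0)
    (h : ∀ t ∈ Set.Ioo (0 : ℝ) 1, 0 ≤ P.eval t) : 0 < ∫ t in (0 : ℝ)..1, P.eval t := by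
  obtain ⟨t, ht, hP⟩ : ∃ t ∈ Set.Ioo (0 : ℝ) 1, P.eval t ≠ 0 := by
    by_contra! H
    exact h0 (Polynomial.eq_zero_of_infinite_isRoot P
      ((Set.Ioo_infinite (zero_lt_one' ℝ)).mono fun t ht => H t ht))
  have hcl : ∀ t ∈ Set.Icc (0 : ℝ) 1, 0 ≤ P.eval t := by
    intro t ht
    rw [← closure_Ioo (zero_ne_one' ℝ)] at ht
    exact closure_minimal (s := Set.Ioo (0 : ℝ) 1) (t := {t | 0 ≤ P.eval t}) (fun t ht => h t ht)
      (isClosed_le continuous_const P.continuous) ht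
  exact intervalIntegral.integral_pos zero_lt_one P.continuous.continuousOn
    (fun t ht => hcl t (Set.Ioc_subset_Icc_self ht))
    ⟨t, Set.Ioo_subset_Icc_self ht, (h t ht).lt_of_ne' hP⟩

open Polynomial in
/-- A node's weight is positive if some polynomial of admissible degree, nonnegative on `[0, 1]`,
vanishes at all the other nodes and not at that node. -/
lemma ExactUpTo.weight_pos {n : ℕ} {ξ w : Fin n → ℝ} {K : ℕ} (h : ExactUpTo ξ w K) (μ : Fin n)
    {P : ℝ[X]} (hK : P.natDegree ≤ K) (h0 : ∀ t ∈ Set.Ioo (0 : ℝ) 1, 0 ≤ P.eval t)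
    (hμ : 0 < P.eval (ξ μ)) (hν : ∀ ν ≠ μ, P.eval (ξ ν) = 0) : 0 < w μ := by
  have hne : P ≠ 0 := by rintro rfl; simp at hμ
  have := integral_eval_pos hne h0
  rw [← h P hK, Finset.sum_eq_single μ (fun ν _ hne => by rw [hν ν hne, mul_zero])
    (by simp)] at this
  exact pos_of_mul_pos_left this hμ.le

open Polynomial in
lemma eval_prod_X_sub_C_ne_zero {ι : Type*} {s : Finset ι} {ξ : ι → ℝ} {t : ℝ}
    (h : ∀ ν ∈ s, t ≠ ξ ν) : (∏ ν ∈ s, (X - C (ξ ν))).eval t ≠ 0 := by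
  rw [eval_prod, Finset.prod_ne_zero_iff]
  intro ν hν
  simpa [sub_eq_zero] using h ν hν

open Polynomial in
lemma natDegree_nodalProd {ι : Type*} (s : Finset ι) (ξ : ι → ℝ) :
    (∏ ν ∈ s, (X - C (ξ ν))).natDegree = s.card := by
  rw [natDegree_prod_of_monic _ _ fun _ _ => monic_X_sub_C _]
  simp

lemma IsGaussRule.exactUpTo {Q : ℕ} {ξ w : Fin Q → ℝ} (h : IsGaussRule ξ w) {K : ℕ}
    (hK : K + 1 ≤ 2 * Q) : ExactUpTo ξ w K :=
  fun P hP => h.2 P (by omega)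

-- The test polynomial is the squared product over the other nodes, of degree 2Q - 2.
open Polynomial in
lemma IsGaussRule.weight_pos {Q : ℕ} {ξ w : Fin Q → ℝ} (h : IsGaussRule ξ w) (μ : Fin Q) :
    0 < w μ := by
  have hQ : 0 < Q := μ.pos
  refine (h.exactUpTo (K := 2 * Q - 1) (by omega)).weight_pos μ
    (P := (∏ ν ∈ Finset.univ.erase μ, (X - C (ξ ν))) ^ 2) ?_ ?_ ?_ ?_
  · refine natDegree_pow_le.trans ?_
    rw [natDegree_nodalProd, Finset.card_erase_of_mem (Finset.mem_univ _)]
    simp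
    omega
  · intro t _
    rw [eval_pow]
    positivity
  · have : (∏ ν ∈ Finset.univ.erase μ, (X - C (ξ ν))).eval (ξ μ) ≠ 0 :=
      eval_prod_X_sub_C_ne_zero fun ν hν =>
        h.1.injective.ne (Finset.ne_of_mem_erase hν).symm
    rw [eval_pow]
    positivity
  · intro ν hν
    rw [eval_pow, eval_prod, Finset.prod_eq_zero (i := ν) (by simp [hν]) (by simp)]
    simp

/-! ### Gauss–Lobatto rules: symmetry and positivity of the weights -/

section Lobatto

open Polynomial

/-- The indices of the interior nodes. -/
def interiorNodes {L : ℕ} (hL : 2 ≤ L) : Finset (Fin L) :=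
  (Finset.univ.erase ⟨0, by omega⟩).erase ⟨L - 1, by omega⟩

/-- The monic polynomial whose roots are the interior nodes. -/
noncomputable def nodal {L : ℕ} (hL : 2 ≤ L) (ξ : Fin L → ℝ) : ℝ[X] :=
  ∏ ν ∈ interiorNodes hL, (X - C (ξ ν))

variable {L : ℕ} {hL : 2 ≤ L} {ξ w : Fin L → ℝ}

lemma IsGaussLobattoRule.exactUpTo (h : IsGaussLobattoRule hL ξ w) {K : ℕ}
    (hK : K + 3 ≤ 2 * L) : ExactUpTo ξ w K :=
  fun P hP => h.2.2.2 P (by omega)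

lemma mem_interiorNodes {ν : Fin L} :
    ν ∈ interiorNodes hL ↔ ν ≠ ⟨L - 1, by omega⟩ ∧ ν ≠ ⟨0, by omega⟩ := by
  simp [interiorNodes]

lemma card_interiorNodes : (interiorNodes hL).card = L - 2 := by
  rw [interiorNodes, Finset.card_erase_of_mem, Finset.card_erase_of_mem (Finset.mem_univ _)]
  · simp
    omega
  · simp
    omega

lemma nodal_monic : (nodal hL ξ).Monic := monic_prod_of_monic _ _ fun _ _ => monic_X_sub_C _

lemma natDegree_nodal : (nodal hL ξ).natDegree = L - 2 := by
  rw [nodal, natDegree_nodalProd, card_interiorNodes]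

lemma eval_nodal_eq_zero {ν : Fin L} (hν : ν ∈ interiorNodes hL) :
    (nodal hL ξ).eval (ξ ν) = 0 := by
  rw [nodal, eval_prod, Finset.prod_eq_zero hν (by simp)]

/-- A polynomial vanishing at both endpoints and divisible by the nodal polynomial integrates
to zero. -/
lemma IsGaussLobattoRule.integral_nodal_mul (h : IsGaussLobattoRule hL ξ w) {P : ℝ[X]}
    (hP : P.natDegree + 3 ≤ L) :
    ∫ t in (0 : ℝ)..1, t * (1 - t) * (nodal hL ξ).eval t * P.eval t = 0 := by
  -- The degree is at most 2 + (L - 2) + (L - 3) = 2L - 3, the limit of exactness, and every node is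
  -- a root.
  have := h.2.2.2 (X * (1 - X) * nodal hL ξ * P) (by
    have h1 : (X * (1 - X) : ℝ[X]).natDegree ≤ 2 := by compute_degree
    have h2 := natDegree_mul_le (p := X * (1 - X) * nodal hL ξ) (q := P)
    have h3 := natDegree_mul_le (p := X * (1 - X)) (q := nodal hL ξ)
    rw [natDegree_nodal] at h3
    omega)
  simp only [eval_mul, eval_X, eval_sub, eval_one] at this
  rw [← this]
  refine Finset.sum_eq_zero fun ν _ => ?_
  by_cases hν : ν ∈ interiorNodes hL
  · rw [eval_nodal_eq_zero hν]
    ring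
  · rw [mem_interiorNodes] at hν
    rcases not_and_or.1 hν with hν | hν <;> rw [not_not] at hν
    · rw [hν, h.2.2.1]
      ring
    · rw [hν, h.2.1]
      ring

lemma integral_reflect (f : ℝ → ℝ) :
    ∫ t in (0 : ℝ)..1, f (1 - t) = ∫ t in (0 : ℝ)..1, f t := by
  simp

lemma eval_nodal_reflect (ξ : Fin L → ℝ) (t : ℝ) :
    (nodal hL fun ν => 1 - ξ ν).eval (1 - t)
      = (-1) ^ (interiorNodes hL).card * (nodal hL ξ).eval t := by
  rw [nodal, nodal, eval_prod, eval_prod, ← Finset.prod_const, ← Finset.prod_mul_distrib]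
  refine Finset.prod_congr rfl fun ν _ => ?_
  simp

/-- The Gauss–Lobatto nodal polynomial is that of the reflected nodes. -/
lemma IsGaussLobattoRule.nodal_reflect (h : IsGaussLobattoRule hL ξ w) :
    nodal hL (fun ν => 1 - ξ ν) = nodal hL ξ := by
  by_contra hne
  set D := nodal hL (fun ν => 1 - ξ ν) - nodal hL ξ with hD
  have hD0 : D ≠ 0 := sub_ne_zero.2 hne
  -- Both polynomials are monic of degree L - 2, so the leading terms cancel. Each is orthogonal to
  -- D for the weight t(1 - t), hence D is orthogonal to itself.
  have hdeg : D.natDegree + 3 ≤ L := by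
    have := natDegree_lt_natDegree hD0 (degree_sub_lt_left (q := nodal hL ξ)
      (by rw [degree_eq_natDegree nodal_monic.ne_zero, degree_eq_natDegree nodal_monic.ne_zero,
          natDegree_nodal, natDegree_nodal]) nodal_monic.ne_zero
      (by rw [nodal_monic.leadingCoeff, nodal_monic.leadingCoeff]))
    rw [natDegree_nodal] at this
    omega
  have e1 := h.integral_nodal_mul hdeg
  have e2 := h.integral_nodal_mul (P := D.comp (1 - X)) (by
    have h1 : (1 - X : ℝ[X]).natDegree ≤ 1 := by compute_degree
    have h2 := natDegree_comp_le (p := D) (q := 1 - X)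
    have h3 := Nat.mul_le_mul_left D.natDegree h1
    omega)
  have e3 : ∫ t in (0 : ℝ)..1, t * (1 - t) * (nodal hL (fun ν => 1 - ξ ν)).eval t * D.eval t
      = 0 := by
    rw [← integral_reflect]
    calc _ = ∫ t in (0 : ℝ)..1, (-1) ^ (interiorNodes hL).card *
          (t * (1 - t) * (nodal hL ξ).eval t * (D.comp (1 - X)).eval t) := by
          congr 1
          funext t
          rw [eval_nodal_reflect, eval_comp]
          simp
          ring
      _ = 0 := by rw [intervalIntegral.integral_const_mul, e2, mul_zero]
  have hpos : 0 < ∫ t in (0 : ℝ)..1, (X * (1 - X) * D ^ 2).eval t := by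
    refine integral_eval_pos ?_ fun t ht => ?_
    · refine mul_ne_zero (mul_ne_zero X_ne_zero fun h => ?_) (pow_ne_zero _ hD0)
      simpa using congrArg (eval 0) h
    · have := ht.1
      have : 0 < 1 - t := sub_pos.2 ht.2
      simp only [eval_mul, eval_X, eval_sub, eval_one, eval_pow]
      positivity
  refine hpos.ne' ?_
  calc _ = ∫ t in (0 : ℝ)..1, (t * (1 - t) * (nodal hL (fun ν => 1 - ξ ν)).eval t * D.eval t
        - t * (1 - t) * (nodal hL ξ).eval t * D.eval t) := by
        congr 1
        funext t
        simp [hD]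
        ring
    _ = 0 := by
      rw [intervalIntegral.integral_sub, e1, e3, sub_zero]
      all_goals exact Continuous.intervalIntegrable (by fun_prop) _ _

lemma IsGaussLobattoRule.eval_nodal_sq_reflect (h : IsGaussLobattoRule hL ξ w) (t : ℝ) :
    (nodal hL ξ).eval (1 - t) ^ 2 = (nodal hL ξ).eval t ^ 2 := by
  have := eval_nodal_reflect (hL := hL) ξ t
  rw [h.nodal_reflect] at this
  rw [this, mul_pow, ← pow_mul, mul_comm _ 2, pow_mul]
  simp

/-- The squared nodal polynomial leaves room for exactly one more degree, 2(L - 2) + 1 = 2L - 3, and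
kills the interior nodes. -/
lemma IsGaussLobattoRule.sum_mul_nodal_sq (h : IsGaussLobattoRule hL ξ w) {P : ℝ[X]}
    (hP : P.natDegree ≤ 1) :
    w ⟨0, by omega⟩ * (P.eval 0 * (nodal hL ξ).eval 0 ^ 2)
      + w ⟨L - 1, by omega⟩ * (P.eval 1 * (nodal hL ξ).eval 1 ^ 2)
      = ∫ t in (0 : ℝ)..1, P.eval t * (nodal hL ξ).eval t ^ 2 := by
  have := h.2.2.2 (P * nodal hL ξ ^ 2) (by
    have h2 := natDegree_mul_le (p := P) (q := nodal hL ξ ^ 2)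
    have h3 := natDegree_pow_le (p := nodal hL ξ) (n := 2)
    rw [natDegree_nodal] at h3
    omega)
  simp only [eval_mul, eval_pow] at this
  rw [← this, Finset.sum_eq_add (⟨0, by omega⟩ : Fin L) ⟨L - 1, by omega⟩, h.2.1, h.2.2.1]
  · simp
    omega
  · intro ν _ hν
    rw [eval_nodal_eq_zero (mem_interiorNodes.2 ⟨hν.2, hν.1⟩)]
    ring
  · simp
  · simp

lemma IsGaussLobattoRule.eval_nodal_zero_ne (h : IsGaussLobattoRule hL ξ w) :
    (nodal hL ξ).eval 0 ≠ 0 := by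
  refine eval_prod_X_sub_C_ne_zero fun ν hν => ?_
  rw [← h.2.1]
  exact h.1.injective.ne (mem_interiorNodes.1 hν).2.symm

/-- The two endpoint weights of a Gauss–Lobatto rule agree. -/
lemma IsGaussLobattoRule.weight_last (h : IsGaussLobattoRule hL ξ w) :
    w ⟨L - 1, by omega⟩ = w ⟨0, by omega⟩ := by
  -- The factors 1 - t and t isolate the two endpoint weights; the reflection t ↦ 1 - t exchanges
  -- the two integrals.
  have e1 := h.sum_mul_nodal_sq (P := 1 - X) (by compute_degree)
  have e2 := h.sum_mul_nodal_sq (P := X) (by compute_degree)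
  have e3 := h.eval_nodal_sq_reflect 0
  rw [← integral_reflect] at e2
  simp only [h.eval_nodal_sq_reflect] at e2
  simp only [eval_X, eval_sub, eval_one] at e1 e2
  rw [sub_zero] at e3
  rw [e3] at e2
  have h0 := h.eval_nodal_zero_ne
  have : w ⟨L - 1, by omega⟩ * (nodal hL ξ).eval 0 ^ 2
      = w ⟨0, by omega⟩ * (nodal hL ξ).eval 0 ^ 2 := by linarith
  exact mul_right_cancel₀ (pow_ne_zero 2 h0) this

lemma IsGaussLobattoRule.weight_zero_pos (h : IsGaussLobattoRule hL ξ w) :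
    0 < w ⟨0, by omega⟩ := by
  have e1 := h.sum_mul_nodal_sq (P := 1 - X) (by compute_degree)
  have hpos : 0 < ∫ t in (0 : ℝ)..1, ((1 - X) * nodal hL ξ ^ 2).eval t := by
    refine integral_eval_pos ?_ fun t ht => ?_
    · refine mul_ne_zero (fun h => ?_) (pow_ne_zero _ nodal_monic.ne_zero)
      simpa using congrArg (eval 0) h
    · have : 0 < 1 - t := sub_pos.2 ht.2
      simp only [eval_mul, eval_X, eval_sub, eval_one, eval_pow]
      positivity
  simp only [eval_mul, eval_pow] at hpos
  rw [← e1] at hpos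
  simp only [eval_sub, eval_one, eval_X, sub_zero, one_mul, sub_self, zero_mul, mul_zero,
    add_zero] at hpos
  exact pos_of_mul_pos_left hpos (sq_nonneg _)

lemma IsGaussLobattoRule.weight_pos (h : IsGaussLobattoRule hL ξ w) (μ : Fin L) : 0 < w μ := by
  by_cases hμ : μ ∈ interiorNodes hL
  · have hμ' := mem_interiorNodes.1 hμ
    have hc := card_interiorNodes (hL := hL)
    have hc0 := Finset.card_pos.2 ⟨μ, hμ⟩
    have h0 : 0 < ξ μ := by
      rw [← h.2.1]
      exact h.1 (lt_of_le_of_ne (Fin.mk_le_of_le_val (Nat.zero_le _)) hμ'.2.symm)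
    have h1 : 0 < 1 - ξ μ := by
      rw [sub_pos, ← h.2.2.1]
      exact h.1 (lt_of_le_of_ne (Fin.le_def.2 (by simp; omega)) hμ'.1)
    -- The factor t(1 - t) removes the endpoints and keeps the sign; the degree is 2 + 2(L - 3).
    refine (h.exactUpTo (K := 2 * L - 3) (by omega)).weight_pos μ
      (P := X * (1 - X) * (∏ ν ∈ (interiorNodes hL).erase μ, (X - C (ξ ν))) ^ 2) ?_ ?_ ?_ ?_
    · have h1 : (X * (1 - X) : ℝ[X]).natDegree ≤ 2 := by compute_degree
      refine natDegree_mul_le.trans ((Nat.add_le_add h1 natDegree_pow_le).trans ?_)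
      rw [natDegree_nodalProd, Finset.card_erase_of_mem hμ]
      omega
    · intro t ht
      have := ht.1
      have : 0 < 1 - t := sub_pos.2 ht.2
      simp only [eval_mul, eval_X, eval_sub, eval_one, eval_pow]
      positivity
    · have : (∏ ν ∈ (interiorNodes hL).erase μ, (X - C (ξ ν))).eval (ξ μ) ≠ 0 :=
        eval_prod_X_sub_C_ne_zero fun ν hν =>
          h.1.injective.ne (Finset.ne_of_mem_erase hν).symm
      simp only [eval_mul, eval_X, eval_sub, eval_one, eval_pow]
      positivity
    · intro ν hν
      simp only [eval_mul, eval_X, eval_sub, eval_one, eval_pow]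
      by_cases hi : ν ∈ interiorNodes hL
      · rw [eval_prod, Finset.prod_eq_zero (i := ν) (by simp [hν, hi]) (by simp)]
        ring
      · rw [mem_interiorNodes] at hi
        rcases not_and_or.1 hi with hi | hi <;> rw [not_not] at hi
        · rw [hi, h.2.2.1]
          ring
        · rw [hi, h.2.1]
          ring
  · rw [mem_interiorNodes] at hμ
    rcases not_and_or.1 hμ with hμ | hμ <;> rw [not_not] at hμ
    · rw [hμ, h.weight_last]
      exact h.weight_zero_pos
    · rw [hμ]
      exact h.weight_zero_pos

end Lobatto

/-! ### Cell averages by tensor-product quadrature -/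

section CellAverage

open Polynomial

lemma ExactUpTo.integral_interval {n : ℕ} {ξ w : Fin n → ℝ} {K : ℕ} (h : ExactUpTo ξ w K)
    {P : ℝ[X]} (hP : P.natDegree ≤ K) (a d : ℝ) :
    ∫ x in a..(a + d), P.eval x = d * ∑ μ, w μ * P.eval (a + ξ μ * d) := by
  have h1 : (C a + X * C d : ℝ[X]).natDegree ≤ 1 := by compute_degree
  have := h (P.comp (C a + X * C d)) (natDegree_comp_le.trans
    ((Nat.mul_le_mul_left _ h1).trans (by omega)))
  simp only [eval_comp, eval_add, eval_C, eval_mul, eval_X] at this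
  rw [this]
  have e := intervalIntegral.mul_integral_comp_add_mul (f := fun x => P.eval x) (a := 0) (b := 1) d a
  simpa [mul_comm] using e.symm

lemma eval_eq_eval_aeval_snd (P : MvPolynomial (Fin 2) ℝ) (x y : ℝ) :
    MvPolynomial.eval ![x, y] P = (MvPolynomial.aeval ![(C x : ℝ[X]), X] P).eval y := by
  induction P using MvPolynomial.induction_on with
  | C a => simp
  | add p q hp hq => simp [hp, hq]
  | mul_X p i hp => fin_cases i <;> simp [hp]

lemma eval_eq_eval_aeval_fst (P : MvPolynomial (Fin 2) ℝ) (x y : ℝ) :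
    MvPolynomial.eval ![x, y] P = (MvPolynomial.aeval ![(X : ℝ[X]), C y] P).eval x := by
  induction P using MvPolynomial.induction_on with
  | C a => simp
  | add p q hp hq => simp [hp, hq]
  | mul_X p i hp => fin_cases i <;> simp [hp]

/-- Tensor products of exact rules compute cell averages. -/
lemma cellAverage_eq_sum (M : Mesh) (U : ℤ → ℤ → PolyState) {i j : ℤ} {K m n : ℕ}
    (hdeg : ∀ k, (U i j k).totalDegree ≤ K) {ξ w : Fin m → ℝ} {η z : Fin n → ℝ}
    (h1 : ExactUpTo ξ w K) (h2 : ExactUpTo η z K) :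
    cellAverage M U i j
      = ∑ ν, ∑ μ, (w ν * z μ) • (U i j).at (M.xPt i (ξ ν)) (M.yPt j (η μ)) := by
  funext k
  have hx : M.xR i = M.xL i + M.Δx := by
    simp only [Mesh.xR, Mesh.xL]
    ring
  have hy : M.yR j = M.yL j + M.Δy := by
    simp only [Mesh.yR, Mesh.yL]
    ring
  have hMx := M.Δx_pos.ne'
  have hMy := M.Δy_pos.ne'
  -- Restriction to a horizontal or vertical line substitutes polynomials of degree at most 1, so
  -- the total degree bounds the degree of the restriction.
  have d1 : ∀ y : ℝ, (MvPolynomial.aeval ![(X : ℝ[X]), C y] (U i j k)).natDegree ≤ K := by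
    intro y
    have := MvPolynomial.aeval_natDegree_le (U i j k) (hdeg k) ![(X : ℝ[X]), C y] (n := 1)
      (by intro l; fin_cases l <;> simp)
    simpa using this
  have d2 : ∀ x : ℝ, (MvPolynomial.aeval ![(C x : ℝ[X]), X] (U i j k)).natDegree ≤ K := by
    intro x
    have := MvPolynomial.aeval_natDegree_le (U i j k) (hdeg k) ![(C x : ℝ[X]), X] (n := 1)
      (by intro l; fin_cases l <;> simp)
    simpa using this
  have inner : ∀ x : ℝ, ∫ y in (M.yL j)..(M.yR j), (U i j).at x y k
      = ∑ μ, (M.Δy * z μ) * (U i j).at x (M.yPt j (η μ)) k := by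
    intro x
    simp only [PolyState.at, eval_eq_eval_aeval_snd]
    rw [hy, h2.integral_interval (d2 x), Finset.mul_sum]
    simp only [Mesh.yPt, mul_assoc]
  have outer : ∀ y : ℝ, ∫ x in (M.xL i)..(M.xR i), (U i j).at x y k
      = ∑ ν, (M.Δx * w ν) * (U i j).at (M.xPt i (ξ ν)) y k := by
    intro y
    simp only [PolyState.at, eval_eq_eval_aeval_fst]
    rw [hx, h1.integral_interval (d1 y), Finset.mul_sum]
    simp only [Mesh.xPt, mul_assoc]
  have hcont : ∀ y : ℝ, Continuous fun x => (U i j).at x y k := by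
    intro y
    simp only [PolyState.at, eval_eq_eval_aeval_fst]
    fun_prop
  rw [cellAverage]
  simp only [inner]
  rw [intervalIntegral.integral_finsetSum
    (fun μ _ => ((hcont _).const_mul _).intervalIntegrable _ _)]
  simp only [intervalIntegral.integral_const_mul, outer, Finset.mul_sum, Finset.sum_apply,
    Pi.smul_apply, smul_eq_mul]
  rw [Finset.sum_comm]
  refine Finset.sum_congr rfl fun ν _ => Finset.sum_congr rfl fun μ _ => ?_
  field_simp

end CellAverage

lemma Mesh.xPt_zero (M : Mesh) (i : ℤ) : M.xPt i 0 = M.xL i := by simp [Mesh.xPt]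

lemma Mesh.yPt_zero (M : Mesh) (j : ℤ) : M.yPt j 0 = M.yL j := by simp [Mesh.yPt]

lemma Mesh.xPt_one (M : Mesh) (i : ℤ) : M.xPt i 1 = M.xR i := by
  simp only [Mesh.xPt, Mesh.xL, Mesh.xR]
  ring

lemma Mesh.yPt_one (M : Mesh) (j : ℤ) : M.yPt j 1 = M.yR j := by
  simp only [Mesh.yPt, Mesh.yL, Mesh.yR]
  ring

/-! ### The generalized Lax–Friedrichs splitting -/

lemma abs_half_norm_sq_sub_le (b b' : V3) :
    |‖b‖ ^ 2 / 2 - ‖b'‖ ^ 2 / 2| ≤ ‖b' - b‖ / √2 * √(‖b‖ ^ 2 + ‖b'‖ ^ 2) := by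
  have h1 : ‖b‖ + ‖b'‖ ≤ √2 * √(‖b‖ ^ 2 + ‖b'‖ ^ 2) := by
    rw [← Real.sqrt_mul (by norm_num)]
    exact Real.le_sqrt_of_sq_le (by nlinarith [sq_nonneg (‖b‖ - ‖b'‖)])
  have h2 : (√2) ^ 2 = 2 := Real.sq_sqrt (by norm_num)
  have h3 : |‖b‖ - ‖b'‖| ≤ ‖b' - b‖ := by
    rw [norm_sub_rev]
    exact abs_norm_sub_norm_le b b'
  calc |‖b‖ ^ 2 / 2 - ‖b'‖ ^ 2 / 2| = |‖b‖ - ‖b'‖| * (‖b‖ + ‖b'‖) / 2 := by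
        rw [show ‖b‖ ^ 2 / 2 - ‖b'‖ ^ 2 / 2 = (‖b‖ - ‖b'‖) * (‖b‖ + ‖b'‖) / 2 by ring, abs_div,
          abs_mul, abs_of_nonneg (by positivity : 0 ≤ ‖b‖ + ‖b'‖), abs_two]
    _ ≤ ‖b' - b‖ * (√2 * √(‖b‖ ^ 2 + ‖b'‖ ^ 2)) / 2 := by gcongr
    _ = _ := by
      field_simp
      rw [h2]
      ring

lemma abs_weighted_add_le {r r' : ℝ} (hr : 0 < r) (hr' : 0 < r') (s s' x x' : ℝ) :
    |s * x + s' * x'| ≤ √(s ^ 2 / r + s' ^ 2 / r') * √(r * x ^ 2 + r' * x' ^ 2) := by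
  rw [← Real.sqrt_mul (by positivity)]
  refine Real.abs_le_sqrt ?_
  -- Lagrange's identity for the weighted Cauchy–Schwarz inequality.
  have : (s ^ 2 / r + s' ^ 2 / r') * (r * x ^ 2 + r' * x' ^ 2)
      = (s * x + s' * x') ^ 2 + (s * x' * r' - s' * x * r) ^ 2 / (r * r') := by
    field_simp
    ring
  rw [this]
  have : 0 ≤ (s * x' * r' - s' * x * r) ^ 2 / (r * r') := by positivity
  linarith

/-- This pays for transporting the shifted magnetic energies of both states with one common velocity
σvᵢ + (1 - σ)ṽᵢ instead of aᵢ. Cauchy–Schwarz on each factor and 2GH ≤ G² + H² give the bound. -/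
lemma cross_term_le {r r' : ℝ} (hr : 0 < r) (hr' : 0 < r') (s s' : ℝ) (u u' b b' : V3)
    (i : Fin 3) :
    |(s * u i + s' * u' i) * (‖b‖ ^ 2 / 2 - ‖b'‖ ^ 2 / 2)|
      ≤ ‖b' - b‖ / √2 * √(s ^ 2 / r + s' ^ 2 / r')
        * (r * ‖u‖ ^ 2 / 2 + r' * ‖u'‖ ^ 2 / 2 + (‖b‖ ^ 2 / 2 + ‖b'‖ ^ 2 / 2)) := by
  rw [abs_mul]
  set G := √(r * u i ^ 2 + r' * u' i ^ 2)
  set H := √(‖b‖ ^ 2 + ‖b'‖ ^ 2)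
  have hG : G ^ 2 = r * u i ^ 2 + r' * u' i ^ 2 := Real.sq_sqrt (by positivity)
  have hH : H ^ 2 = ‖b‖ ^ 2 + ‖b'‖ ^ 2 := Real.sq_sqrt (by positivity)
  have h1 := mul_le_mul_of_nonneg_left (sq_coord_le u i) hr.le
  have h2 := mul_le_mul_of_nonneg_left (sq_coord_le u' i) hr'.le
  calc _ ≤ (√(s ^ 2 / r + s' ^ 2 / r') * G) * (‖b' - b‖ / √2 * H) :=
        mul_le_mul (abs_weighted_add_le hr hr' _ _ _ _) (abs_half_norm_sq_sub_le _ _)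
          (abs_nonneg _) (by positivity)
    _ = ‖b' - b‖ / √2 * √(s ^ 2 / r + s' ^ 2 / r') * (G * H) := by ring
    _ ≤ _ := by
      refine mul_le_mul_of_nonneg_left ?_ (by positivity)
      nlinarith [sq_nonneg (G - H)]

/-- Strict inequality supplies a suitable σ, so attainment of the minimum plays no role. -/
lemma exists_alphaSigma_lt {p : ℝ → ℝ → ℝ} {i : Fin 3} {U U' : State} {α : ℝ}
    (h : alpha p i U U' < α) : ∃ σ, alphaSigma p i U U' σ < α :=
  exists_lt_of_ciInf_lt h

lemma abs_vel_lt_of_alpha_lt {p : ℝ → ℝ → ℝ} (hp : IsEOS p) {i : Fin 3} {U U' : State}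
    (hU : U ∈ admissible) (hU' : U' ∈ admissible) {α : ℝ} (h : alpha p i U U' < α) :
    |vel U i| < α ∧ |vel U' i| < α := by
  obtain ⟨σ, hσ⟩ := exists_alphaSigma_lt h
  have h1 := ci_pos hp hU i
  have h2 := ci_pos hp hU' i
  have h3 : 0 ≤ ‖mag U' - mag U‖ / √2 * √(σ ^ 2 / rho U + (1 - σ) ^ 2 / rho U') := by positivity
  rw [alphaSigma] at hσ
  have h4 := lt_of_le_of_lt (le_add_of_nonneg_right h3) hσ
  simp only [max_lt_iff] at h4
  exact ⟨by linarith [h4.1.1], by linarith [h4.1.2]⟩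

/-- The generalized Lax–Friedrichs splitting property. -/
lemma normalVec_flux_sub_lt {p : ℝ → ℝ → ℝ} (hp : IsEOS p) {i : Fin 3} {U U' : State}
    (hU : U ∈ admissible) (hU' : U' ∈ admissible) {α : ℝ} (h : alpha p i U U' < α) (a c : V3) :
    normalVec a c ⬝ᵥ flux p i U - normalVec a c ⬝ᵥ flux p i U'
        - inner ℝ a c * (mag U i - mag U' i)
      < α * (normalVec a c ⬝ᵥ U + normalVec a c ⬝ᵥ U' + 2 * (‖c‖ ^ 2 / 2)) := by
  obtain ⟨σ, hσ⟩ := exists_alphaSigma_lt h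
  have hr := hU.1
  have hr' := hU'.1
  have hε := hU.2
  have hε' := hU'.2
  have hX := normalVec_dotProduct a c hr.ne'
  have hX' := normalVec_dotProduct a c hr'.ne'
  have hF := normalVec_dotProduct_flux p i a c hr.ne'
  have hF' := normalVec_dotProduct_flux p i a c hr'.ne'
  have hW := (le_abs_self _).trans
    (abs_pressure_magnetic_work_le hp hU i (vel U - a) (mag U - c))
  have hW' := (neg_le_abs _).trans
    (abs_pressure_magnetic_work_le hp hU' i (vel U' - a) (mag U' - c))
  have hC := (neg_le_abs _).trans (cross_term_le hr hr' σ (1 - σ) (vel U - a) (vel U' - a)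
    (mag U - c) (mag U' - c) i)
  have hpos := normalVec_dotProduct_pos a c hU
  have hpos' := normalVec_dotProduct_pos a c hU'
  simp only [PiLp.sub_apply, sub_sub_sub_cancel_right] at hW hW' hC
  rw [alphaSigma] at hσ
  set D := ‖mag U' - mag U‖ / √2 * √(σ ^ 2 / rho U + (1 - σ) ^ 2 / rho U')
  have hD : 0 ≤ D := by positivity
  set m := max (max (|vel U i| + ci p i U) (|vel U' i| + ci p i U'))
      (|σ * vel U i + (1 - σ) * vel U' i| + max (ci p i U) (ci p i U')) with hm
  have m1 : |vel U i| + ci p i U ≤ m := (le_max_left _ _).trans (le_max_left _ _)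
  have m2 : |vel U' i| + ci p i U' ≤ m := (le_max_right _ _).trans (le_max_left _ _)
  have m3 : |σ * vel U i + (1 - σ) * vel U' i| + ci p i U ≤ m :=
    (add_le_add_right (le_max_left _ _) _).trans (le_max_right _ _)
  have m4 : |σ * vel U i + (1 - σ) * vel U' i| + ci p i U' ≤ m :=
    (add_le_add_right (le_max_right _ _) _).trans (le_max_right _ _)
  have hT : 0 ≤ rho U * ‖vel U - a‖ ^ 2 / 2 := by positivity
  have hT' : 0 ≤ rho U' * ‖vel U' - a‖ ^ 2 / 2 := by positivity
  have hb : 0 ≤ ‖mag U - c‖ ^ 2 / 2 := by positivity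
  have hb' : 0 ≤ ‖mag U' - c‖ ^ 2 / 2 := by positivity
  set T := rho U * ‖vel U - a‖ ^ 2 / 2
  set T' := rho U' * ‖vel U' - a‖ ^ 2 / 2
  set b := ‖mag U - c‖ ^ 2 / 2
  set b' := ‖mag U' - c‖ ^ 2 / 2
  set ε := internalEnergy U
  set ε' := internalEnergy U'
  set vσ := σ * vel U i + (1 - σ) * vel U' i
  -- Writing aᵢ(b - b') = vσ(b - b') - (vσ - aᵢ)(b - b'), the coefficients of T + ε, T' + ε', b and
  -- b' are each at most m. The remaining product is `hC` and costs D; strictness comes from m + D <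
  -- α.
  have k1 := mul_le_mul_of_nonneg_right ((add_le_add_left (le_abs_self _) _).trans m1)
    (add_nonneg hT hε.le)
  have k2 := mul_le_mul_of_nonneg_right ((add_le_add_left (neg_le_abs _) _).trans m2)
    (add_nonneg hT' hε'.le)
  have k3 := mul_le_mul_of_nonneg_right ((add_le_add_left (le_abs_self _) _).trans m3) hb
  have k4 := mul_le_mul_of_nonneg_right ((add_le_add_left (neg_le_abs _) _).trans m4) hb'
  have k5 := mul_lt_mul_of_pos_right hσ (add_pos hpos hpos')
  have k6 : D * (T + T' + (b + b')) ≤ D * (T + b + ε + (T' + b' + ε')) :=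
    mul_le_mul_of_nonneg_left (by linarith) hD
  have hs : (σ * (vel U i - a i) + (1 - σ) * (vel U' i - a i)) = vσ - a i := by ring
  rw [hs] at hC
  rw [hX, hX'] at k5
  have e : normalVec a c ⬝ᵥ U + normalVec a c ⬝ᵥ U' + 2 * (‖c‖ ^ 2 / 2)
      = (T + b + ε) + (T' + b' + ε') := by linarith
  rw [hF, hF', e]
  linarith

/-! ### Propagation of an affine functional by the scheme -/

/-- The scheme preserves the positivity of an affine functional that is positive on admissible
states and has a generalized Lax–Friedrichs splitting property. -/
lemma updatedAverage_functional_pos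
    {p : ℝ → ℝ → ℝ} (M : Mesh) {K Q L : ℕ} (hQ : K + 1 ≤ 2 * Q) {hL : 2 ≤ L}
    (hKL : K + 3 ≤ 2 * L)
    {ξ ω : Fin Q → ℝ} (hGauss : IsGaussRule ξ ω)
    {ξhat ωhat : Fin L → ℝ} (hLobatto : IsGaussLobattoRule hL ξhat ωhat)
    {U : ℤ → ℤ → PolyState} {i j : ℤ}
    (hdeg : ∀ k, (U i j k).totalDegree ≤ K)
    (hdiv : discreteDiv M ξ ω U i j = 0)
    (hadm : ∀ (μ : Fin Q) (ν : Fin L),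
      (U i j).at (M.xPt i (ξhat ν)) (M.yPt j (ξ μ)) ∈ admissible ∧
      (U i j).at (M.xPt i (ξ μ)) (M.yPt j (ξhat ν)) ∈ admissible)
    {α₁ α₂ Δt : ℝ} (hα₁ : 0 < α₁) (hα₂ : 0 < α₂) (hΔt : 0 < Δt)
    (hCFL : α₁ * Δt / M.Δx + α₂ * Δt / M.Δy ≤ ωhat ⟨0, two_pos.trans_le hL⟩)
    (n : State) (κ τ : ℝ) (hpos : ∀ V ∈ admissible, 0 < n ⬝ᵥ V + κ)
    (hx : ∀ μ,
      (n ⬝ᵥ flux p 0 (xPlus M ξ U i j μ) - n ⬝ᵥ flux p 0 (xPlus M ξ U (i - 1) j μ)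
          - τ * (mag (xPlus M ξ U i j μ) 0 - mag (xPlus M ξ U (i - 1) j μ) 0)
        < α₁ * (n ⬝ᵥ xPlus M ξ U i j μ + n ⬝ᵥ xPlus M ξ U (i - 1) j μ + 2 * κ)) ∧
      (n ⬝ᵥ flux p 0 (xMinus M ξ U i j μ) - n ⬝ᵥ flux p 0 (xMinus M ξ U (i - 1) j μ)
          - τ * (mag (xMinus M ξ U i j μ) 0 - mag (xMinus M ξ U (i - 1) j μ) 0)
        < α₁ * (n ⬝ᵥ xMinus M ξ U i j μ + n ⬝ᵥ xMinus M ξ U (i - 1) j μ + 2 * κ)))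
    (hy : ∀ μ,
      (n ⬝ᵥ flux p 1 (yPlus M ξ U i j μ) - n ⬝ᵥ flux p 1 (yPlus M ξ U i (j - 1) μ)
          - τ * (mag (yPlus M ξ U i j μ) 1 - mag (yPlus M ξ U i (j - 1) μ) 1)
        < α₂ * (n ⬝ᵥ yPlus M ξ U i j μ + n ⬝ᵥ yPlus M ξ U i (j - 1) μ + 2 * κ)) ∧
      (n ⬝ᵥ flux p 1 (yMinus M ξ U i j μ) - n ⬝ᵥ flux p 1 (yMinus M ξ U i (j - 1) μ)
          - τ * (mag (yMinus M ξ U i j μ) 1 - mag (yMinus M ξ U i (j - 1) μ) 1)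
        < α₂ * (n ⬝ᵥ yMinus M ξ U i j μ + n ⬝ᵥ yMinus M ξ U i (j - 1) μ + 2 * κ))) :
    0 < n ⬝ᵥ updatedAverage M ξ ω U p α₁ α₂ Δt i j + κ := by
  have hw := hGauss.weight_pos
  have hne : (Finset.univ : Finset (Fin Q)).Nonempty := ⟨⟨0, by omega⟩, Finset.mem_univ _⟩
  have hG := hGauss.exactUpTo hQ
  have hLo := hLobatto.exactUpTo hKL
  have hMx := M.Δx_pos
  have hMy := M.Δy_pos
  have lf : ∀ (l : Fin 3) (α : ℝ) (A B : State), n ⬝ᵥ lfFlux p l α A B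
      = (n ⬝ᵥ flux p l A + n ⬝ᵥ flux p l B - α * (n ⬝ᵥ B - n ⬝ᵥ A)) / 2 := by
    intro l α A B
    simp only [lfFlux, dotProduct_smul, dotProduct_sub, dotProduct_add, smul_eq_mul]
    ring
  -- flux differences
  set Sx := ∑ μ, ω μ * (n ⬝ᵥ xPlus M ξ U (i - 1) j μ + n ⬝ᵥ xMinus M ξ U i j μ + 2 * κ) with hSx
  set Sy := ∑ μ, ω μ * (n ⬝ᵥ yPlus M ξ U i (j - 1) μ + n ⬝ᵥ yMinus M ξ U i j μ + 2 * κ) with hSy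
  have fx : ∑ μ, ω μ * (n ⬝ᵥ lfFlux p 0 α₁ (xMinus M ξ U i j μ) (xPlus M ξ U i j μ)
        - n ⬝ᵥ lfFlux p 0 α₁ (xMinus M ξ U (i - 1) j μ) (xPlus M ξ U (i - 1) j μ))
      < τ * ∑ μ, ω μ * (meanB₁ M ξ U i j μ - meanB₁ M ξ U (i - 1) j μ) + α₁ * Sx := by
    rw [hSx, Finset.mul_sum, Finset.mul_sum, ← Finset.sum_add_distrib]
    refine Finset.sum_lt_sum_of_nonempty hne fun μ _ => ?_
    rw [mul_left_comm τ, mul_left_comm α₁, ← mul_add]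
    refine mul_lt_mul_of_pos_left ?_ (hw μ)
    rw [lf, lf, meanB₁, meanB₁]
    -- In half the sum of the two estimates, the traces from the neighbouring cells cancel against
    -- the viscous terms; both inner traces remain with coefficient α₁.
    linarith [(hx μ).1, (hx μ).2]
  have fy : ∑ μ, ω μ * (n ⬝ᵥ lfFlux p 1 α₂ (yMinus M ξ U i j μ) (yPlus M ξ U i j μ)
        - n ⬝ᵥ lfFlux p 1 α₂ (yMinus M ξ U i (j - 1) μ) (yPlus M ξ U i (j - 1) μ))
      < τ * ∑ μ, ω μ * (meanB₂ M ξ U i j μ - meanB₂ M ξ U i (j - 1) μ) + α₂ * Sy := by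
    rw [hSy, Finset.mul_sum, Finset.mul_sum, ← Finset.sum_add_distrib]
    refine Finset.sum_lt_sum_of_nonempty hne fun μ _ => ?_
    rw [mul_left_comm τ, mul_left_comm α₂, ← mul_add]
    refine mul_lt_mul_of_pos_left ?_ (hw μ)
    rw [lf, lf, meanB₂, meanB₂]
    linarith [(hy μ).1, (hy μ).2]
  -- the cell average dominates the contributions of the Gauss–Lobatto endpoints
  have hends : ∀ g : Fin L → ℝ, (∀ ν, 0 < g ν) →
      ωhat ⟨0, two_pos.trans_le hL⟩ * (g ⟨0, two_pos.trans_le hL⟩ + g ⟨L - 1, by omega⟩) ≤ ∑ ν, ωhat ν * g ν := by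
    intro g hg
    have h01 : (⟨0, two_pos.trans_le hL⟩ : Fin L) ≠ ⟨L - 1, by omega⟩ := by
      simp
      omega
    rw [mul_add]
    nth_rw 2 [← hLobatto.weight_last]
    rw [← Finset.sum_pair h01 (f := fun ν => ωhat ν * g ν)]
    exact Finset.sum_le_sum_of_subset_of_nonneg (Finset.subset_univ _)
      fun ν _ _ => (mul_pos (hLobatto.weight_pos ν) (hg ν)).le
  have avgx : ωhat ⟨0, two_pos.trans_le hL⟩ * Sx ≤ n ⬝ᵥ cellAverage M U i j + κ := by
    have : n ⬝ᵥ cellAverage M U i j + κ = ∑ μ, ω μ * ∑ ν, ωhat ν *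
        (n ⬝ᵥ (U i j).at (M.xPt i (ξhat ν)) (M.yPt j (ξ μ)) + κ) := by
      rw [cellAverage_eq_sum M U hdeg hLo hG, Finset.sum_comm]
      simp only [mul_add, Finset.sum_add_distrib, ← Finset.sum_mul, hLo.sum_weights, one_mul,
        hG.sum_weights, dotProduct_sum, dotProduct_smul, smul_eq_mul, Finset.mul_sum]
      congr 1
      exact Finset.sum_congr rfl fun μ _ => Finset.sum_congr rfl fun ν _ => by ring
    rw [this, hSx, Finset.mul_sum]
    refine Finset.sum_le_sum fun μ _ => ?_
    rw [mul_left_comm]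
    refine mul_le_mul_of_nonneg_left ?_ (hw μ).le
    refine le_trans (le_of_eq ?_) (hends _ fun ν => hpos _ (hadm μ ν).1)
    rw [hLobatto.2.1, hLobatto.2.2.1, Mesh.xPt_one, Mesh.xPt_zero, xPlus, xMinus, sub_add_cancel]
    ring
  have avgy : ωhat ⟨0, two_pos.trans_le hL⟩ * Sy ≤ n ⬝ᵥ cellAverage M U i j + κ := by
    have : n ⬝ᵥ cellAverage M U i j + κ = ∑ μ, ω μ * ∑ ν, ωhat ν *
        (n ⬝ᵥ (U i j).at (M.xPt i (ξ μ)) (M.yPt j (ξhat ν)) + κ) := by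
      rw [cellAverage_eq_sum M U hdeg hG hLo]
      simp only [mul_add, Finset.sum_add_distrib, ← Finset.sum_mul, hLo.sum_weights, one_mul,
        hG.sum_weights, dotProduct_sum, dotProduct_smul, smul_eq_mul, Finset.mul_sum]
      congr 1
      exact Finset.sum_congr rfl fun μ _ => Finset.sum_congr rfl fun ν _ => by ring
    rw [this, hSy, Finset.mul_sum]
    refine Finset.sum_le_sum fun μ _ => ?_
    rw [mul_left_comm]
    refine mul_le_mul_of_nonneg_left ?_ (hw μ).le
    refine le_trans (le_of_eq ?_) (hends _ fun ν => hpos _ (hadm μ ν).2)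
    rw [hLobatto.2.1, hLobatto.2.2.1, Mesh.yPt_one, Mesh.yPt_zero, yPlus, yMinus, sub_add_cancel]
    ring
  have hupd : n ⬝ᵥ updatedAverage M ξ ω U p α₁ α₂ Δt i j = n ⬝ᵥ cellAverage M U i j
      - Δt / M.Δx * ∑ μ, ω μ * (n ⬝ᵥ lfFlux p 0 α₁ (xMinus M ξ U i j μ) (xPlus M ξ U i j μ)
        - n ⬝ᵥ lfFlux p 0 α₁ (xMinus M ξ U (i - 1) j μ) (xPlus M ξ U (i - 1) j μ))
      - Δt / M.Δy * ∑ μ, ω μ * (n ⬝ᵥ lfFlux p 1 α₂ (yMinus M ξ U i j μ) (yPlus M ξ U i j μ)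
        - n ⬝ᵥ lfFlux p 1 α₂ (yMinus M ξ U i (j - 1) μ) (yPlus M ξ U i (j - 1) μ)) := by
    simp only [updatedAverage, dotProduct_sub, dotProduct_smul, dotProduct_sum, smul_eq_mul]
  have gx := mul_lt_mul_of_pos_left fx (div_pos hΔt hMx)
  have gy := mul_lt_mul_of_pos_left fy (div_pos hΔt hMy)
  rw [discreteDiv] at hdiv
  set Dx := ∑ μ, ω μ * (meanB₁ M ξ U i j μ - meanB₁ M ξ U (i - 1) j μ)
  set Dy := ∑ μ, ω μ * (meanB₂ M ξ U i j μ - meanB₂ M ξ U i (j - 1) μ)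
  -- The same τ in both directions is what lets the discrete divergence factor out.
  have hdiv' : Δt / M.Δx * (τ * Dx) + Δt / M.Δy * (τ * Dy) = 0 := by
    linear_combination Δt * τ * hdiv
  have e1 : Δt / M.Δx * (α₁ * Sx) = α₁ * Δt / M.Δx * Sx := by ring
  have e2 : Δt / M.Δy * (α₂ * Sy) = α₂ * Δt / M.Δy * Sy := by ring
  rw [mul_add, e1] at gx
  rw [mul_add, e2] at gy
  have hl1 : 0 < α₁ * Δt / M.Δx := by positivity
  have hl2 : 0 < α₂ * Δt / M.Δy := by positivity
  set l₁ := α₁ * Δt / M.Δx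
  set l₂ := α₂ * Δt / M.Δy
  have hW := hLobatto.weight_zero_pos
  set W := ωhat ⟨0, two_pos.trans_le hL⟩
  set A := n ⬝ᵥ cellAverage M U i j + κ with hA
  have hA0 : 0 ≤ A := by
    refine le_trans (mul_nonneg hW.le (Finset.sum_nonneg fun μ _ => ?_)) avgx
    refine mul_nonneg (hw μ).le ?_
    have q1 := hpos _ (hadm μ ⟨0, two_pos.trans_le hL⟩).1
    have q2 := hpos _ (hadm μ ⟨L - 1, by omega⟩).1
    rw [hLobatto.2.1, Mesh.xPt_zero] at q1
    rw [hLobatto.2.2.1, Mesh.xPt_one] at q2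
    rw [xPlus, xMinus, sub_add_cancel]
    linarith
  -- After multiplication by W the left side is at most (l₁ + l₂)A, which is at most WA by the CFL
  -- condition and A ≥ 0.
  have key : l₁ * Sx + l₂ * Sy ≤ A := by
    refine le_of_mul_le_mul_left ?_ hW
    have q1 := mul_le_mul_of_nonneg_left avgx hl1.le
    have q2 := mul_le_mul_of_nonneg_left avgy hl2.le
    have q3 := mul_le_mul_of_nonneg_right hCFL hA0
    linarith
  rw [hupd]
  linarith

end MHD

/-! ### Conclusion: density and internal energy -/

theorem theorem4p7
    -- equation of state
    (p : ℝ → ℝ → ℝ) (hp : IsEOS p)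
    -- mesh, and the index set of the cells that make up the spatial domain
    (M : Mesh) (Ω : Set (ℤ × ℤ))
    -- polynomial degree, Gauss rule and Gauss–Lobatto rule
    (K Q L : ℕ) (hQ : K + 1 ≤ 2 * Q) (hL : 2 ≤ L) (hKL : K + 3 ≤ 2 * L)
    (ξ ω : Fin Q → ℝ) (hGauss : IsGaussRule ξ ω)
    (ξhat ωhat : Fin L → ℝ) (hLobatto : IsGaussLobattoRule hL ξhat ωhat)
    -- the polynomial solution at the current time level
    (U : ℤ → ℤ → PolyState)
    (hdeg : ∀ i j, (i, j) ∈ Ω → ∀ k, (U i j k).totalDegree ≤ K)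
    -- discrete divergence-free condition
    (hdiv : ∀ i j, (i, j) ∈ Ω → discreteDiv M ξ ω U i j = 0)
    -- admissibility at the quadrature points
    (hadm : ∀ i j, InStencil Ω i j → ∀ (μ : Fin Q) (ν : Fin L),
      (U i j).at (M.xPt i (ξhat ν)) (M.yPt j (ξ μ)) ∈ admissible ∧
      (U i j).at (M.xPt i (ξ μ)) (M.yPt j (ξhat ν)) ∈ admissible)
    -- numerical viscosity parameters
    (α₁ α₂ : ℝ)
    (hα₁ : ∀ i j, (i, j) ∈ Ω → ∀ μ,
      alpha p 0 (xPlus M ξ U i j μ) (xPlus M ξ U (i - 1) j μ) < α₁ ∧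
      alpha p 0 (xMinus M ξ U i j μ) (xMinus M ξ U (i - 1) j μ) < α₁)
    (hα₂ : ∀ i j, (i, j) ∈ Ω → ∀ μ,
      alpha p 1 (yPlus M ξ U i j μ) (yPlus M ξ U i (j - 1) μ) < α₂ ∧
      alpha p 1 (yMinus M ξ U i j μ) (yMinus M ξ U i (j - 1) μ) < α₂)
    -- CFL condition
    (Δt : ℝ)
    (hCFL_pos : 0 < α₁ * Δt / M.Δx + α₂ * Δt / M.Δy)
    (hCFL_le : α₁ * Δt / M.Δx + α₂ * Δt / M.Δy ≤ ωhat ⟨0, by omega⟩) :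
    ∀ i j, (i, j) ∈ Ω → updatedAverage M ξ ω U p α₁ α₂ Δt i j ∈ admissible := by
  intro i j hij
  have hxm : ∀ i j μ, InStencil Ω i j → xMinus M ξ U i j μ ∈ admissible := by
    intro i j μ h
    have := (hadm i j h μ ⟨L - 1, by omega⟩).1
    rwa [hLobatto.2.2.1, Mesh.xPt_one] at this
  have hxp : ∀ i j μ, InStencil Ω (i + 1) j → xPlus M ξ U i j μ ∈ admissible := by
    intro i j μ h
    have := (hadm (i + 1) j h μ ⟨0, by omega⟩).1
    rwa [hLobatto.2.1, Mesh.xPt_zero] at this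
  have hym : ∀ i j μ, InStencil Ω i j → yMinus M ξ U i j μ ∈ admissible := by
    intro i j μ h
    have := (hadm i j h μ ⟨L - 1, by omega⟩).2
    rwa [hLobatto.2.2.1, Mesh.yPt_one] at this
  have hyp : ∀ i j μ, InStencil Ω i (j + 1) → yPlus M ξ U i j μ ∈ admissible := by
    intro i j μ h
    have := (hadm i (j + 1) h μ ⟨0, by omega⟩).2
    rwa [hLobatto.2.1, Mesh.yPt_zero] at this
  have s0 : InStencil Ω i j := Or.inl hij
  have aXp := fun μ => hxp i j μ (by simp [InStencil, hij])
  have aXp' := fun μ => hxp (i - 1) j μ (by simp [InStencil, hij])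
  have aXm := fun μ => hxm i j μ s0
  have aXm' := fun μ => hxm (i - 1) j μ (by simp [InStencil, hij])
  have aYp := fun μ => hyp i j μ (by simp [InStencil, hij])
  have aYp' := fun μ => hyp i (j - 1) μ (by simp [InStencil, hij])
  have aYm := fun μ => hym i j μ s0
  have aYm' := fun μ => hym i (j - 1) μ (by simp [InStencil, hij])
  have hMx := M.Δx_pos
  have hMy := M.Δy_pos
  have μ₀ : Fin Q := ⟨0, by omega⟩
  have p1 : 0 < α₁ := (abs_nonneg _).trans_lt
    (abs_vel_lt_of_alpha_lt hp (aXp μ₀) (aXp' μ₀) (hα₁ i j hij μ₀).1).1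
  have p2 : 0 < α₂ := (abs_nonneg _).trans_lt
    (abs_vel_lt_of_alpha_lt hp (aYp μ₀) (aYp' μ₀) (hα₂ i j hij μ₀).1).1
  -- The CFL condition only bounds a sum; the sign of Δt follows because both viscosities are
  -- positive.
  have hΔt : 0 < Δt := by
    have : α₁ * Δt / M.Δx + α₂ * Δt / M.Δy = (α₁ / M.Δx + α₂ / M.Δy) * Δt := by ring
    rw [this] at hCFL_pos
    exact pos_of_mul_pos_right hCFL_pos (by positivity)
  have main := updatedAverage_functional_pos (p := p) M hQ hKL hGauss hLobatto (hdeg i j hij)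
    (hdiv i j hij) (hadm i j s0) p1 p2 hΔt hCFL_le
  -- Density is handled first, since completing the square divides by ρ. Its flux is ρ vₗ, so the
  -- splitting needs no magnetic correction (κ = τ = 0) and follows from |vₗ| < α.
  have density : ∀ (l : Fin 3) (V V' : State) (α : ℝ), V ∈ admissible → V' ∈ admissible →
      alpha p l V V' < α →
      (Pi.single 0 1 : State) ⬝ᵥ flux p l V - (Pi.single 0 1 : State) ⬝ᵥ flux p l V'
          - 0 * (mag V l - mag V' l)
        < α * ((Pi.single 0 1 : State) ⬝ᵥ V + (Pi.single 0 1 : State) ⬝ᵥ V' + 2 * 0) := by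
    intro l V V' α hV hV' h
    obtain ⟨h1, h2⟩ := abs_vel_lt_of_alpha_lt hp hV hV' h
    have q1 := mul_lt_mul_of_pos_right ((le_abs_self _).trans_lt h1) hV.1
    have q2 := mul_lt_mul_of_pos_right ((neg_le_abs _).trans_lt h2) hV'.1
    have f0 : ∀ V, flux p l V 0 = rho V * vel V l := fun _ => rfl
    simp only [single_one_dotProduct, f0]
    simp only [rho] at *
    linarith
  refine mem_admissible_of_normalVec ?_ fun a c => ?_
  · have := main (Pi.single 0 1) 0 0 (fun V hV => by simpa [rho] using hV.1)
      (fun μ => ⟨density 0 _ _ _ (aXp μ) (aXp' μ) (hα₁ i j hij μ).1,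
        density 0 _ _ _ (aXm μ) (aXm' μ) (hα₁ i j hij μ).2⟩)
      (fun μ => ⟨density 1 _ _ _ (aYp μ) (aYp' μ) (hα₂ i j hij μ).1,
        density 1 _ _ _ (aYm μ) (aYm' μ) (hα₂ i j hij μ).2⟩)
    simpa [rho] using this
  · exact main (normalVec a c) (‖c‖ ^ 2 / 2) (inner ℝ a c)
      (fun V hV => normalVec_dotProduct_pos a c hV)
      (fun μ => ⟨normalVec_flux_sub_lt hp (aXp μ) (aXp' μ) (hα₁ i j hij μ).1 a c,
        normalVec_flux_sub_lt hp (aXm μ) (aXm' μ) (hα₁ i j hij μ).2 a c⟩)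
      (fun μ => ⟨normalVec_flux_sub_lt hp (aYp μ) (aYp' μ) (hα₂ i j hij μ).1 a c,
        normalVec_flux_sub_lt hp (aYm μ) (aYm' μ) (hα₂ i j hij μ).2 a c⟩)
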